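/- Let $A\in\mathbb R^{d\times d}$, $B\in\mathbb R^{d\times q}$, $K\in\mathbb R^{q\times d}$ be such that $A+BK$ is Hurwitz (all its eigenvalues have negative real part), and let $W:\mathbb R\to\mathbb R^{q\times p}$ be a (Lebesgue measurable) matrix function. Assume that (i) $W$ is uniformly bounded: there is $C>0$ with $\|W(t)\|<C$ for all $t\in\mathbb R$; (ii) $W^TW$ is persistently exciting: there are $\delta>0$, $c_1>0$ and $c_2>0$ such that for every $t_0\ge 0$ $$c_1 I \succ \int_{t_0}^{t_0+\delta} W(t)^TW(t)\,dt \succ c_2 I ,$$ where $X\succ Y$ means that $X-Y$ is positive definite. Let $\Phi(t_1,t_2)$, $t_1,t_2\in\mathbb R$, be the state transition matrix of the linear time-varying system of tracking and parameter errors $$\begin{bmatrix}\dot e\\ \dot\phi\end{bmatrix}=\begin{bmatrix}A+BK & BW(t)\\ 0& -W(t)^TW(t)\end{bmatrix}\begin{bmatrix}e\\ \phi\end{bmatrix},$$ that is, for each $t_2$ the function $t\mapsto\Phi(t,t_2)$ is the (Carathéodory) solution of $\frac{d}{dt}\Phi(t,t_2)=F(t)\Phi(t,t_2)$, $\Phi(t_2,t_2)=I$,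 where $F(t)$ is the block matrix above. Then there exist $M>0$ and $\zeta>0$ such that for all $t_1\ge t_2\ge 0$ $$\|\Phi(t_1,t_2)\|\le M e^{-\zeta(t_1-t_2)} .$$ That is, the idealized error dynamics are exponentially stable (uniformly in the initial time $t_2 \ge 0$). -/

import Mathlib

open MeasureTheory Set
open scoped Matrix Matrix.Norms.L2Operator

/-- A real square matrix is Hurwitz if all its complex eigenvalues have negative real part. -/
def IsHurwitz {ι : Type*} [Fintype ι] [DecidableEq ι] (M : Matrix ι ι ℝ) : Prop :=
  ∀ z ∈ spectrum ℂ (M.map (algebraMap ℝ ℂ)), z.re < 0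

/-- `W` is persistently exciting: there are `δ, c₁, c₂ > 0` such that, for every `t₀ ≥ 0`,
`c₁ I > ∫_{t₀}^{t₀ + δ} Wᵀ(t) W(t) dt > c₂ I` in the sense of positive definiteness. -/
def PersistentlyExciting {q p : ℕ} (W : ℝ → Matrix (Fin q) (Fin p) ℝ) : Prop :=
  ∃ δ > (0 : ℝ), ∃ c₁ > (0 : ℝ), ∃ c₂ > (0 : ℝ), ∀ t₀ ≥ (0 : ℝ),
    (c₁ • (1 : Matrix (Fin p) (Fin p) ℝ) - ∫ t in t₀..(t₀ + δ), (W t)ᵀ * W t).PosDef ∧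
    ((∫ t in t₀..(t₀ + δ), (W t)ᵀ * W t) - c₂ • (1 : Matrix (Fin p) (Fin p) ℝ)).PosDef

/-- The matrix `[[A + B K, B W(t)], [0, -Wᵀ(t) W(t)]]` of the joint dynamics of the tracking
error and of the parameter error. -/
def errorDynamics {d q p : ℕ} (A : Matrix (Fin d) (Fin d) ℝ) (B : Matrix (Fin d) (Fin q) ℝ)
    (K : Matrix (Fin q) (Fin d) ℝ) (W : ℝ → Matrix (Fin q) (Fin p) ℝ) (t : ℝ) :
    Matrix (Fin d ⊕ Fin p) (Fin d ⊕ Fin p) ℝ :=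
  Matrix.fromBlocks (A + B * K) (B * W t) 0 (-((W t)ᵀ * W t))

/-- `Φ` is the state transition matrix of `x' = F(t) x`: for each `s`, the function `Φ(·, s)` is
the (Carathéodory) solution on the whole line of `d/dt Φ(t, s) = F(t) Φ(t, s)`, `Φ(s, s) = I`.
That is, it is locally absolutely continuous and satisfies the equation for almost every `t`
(for every `t`, if `F` is continuous). Norms of matrices are Euclidean operator norms. -/
structure IsStateTransitionMatrix {ι : Type*} [Fintype ι] [DecidableEq ι]
    (F : ℝ → Matrix ι ι ℝ) (Φ : ℝ → ℝ → Matrix ι ι ℝ) : Prop where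
  absolutelyContinuous : ∀ s a b : ℝ, AbsolutelyContinuousOnInterval (fun t => Φ t s) a b
  hasDerivAt : ∀ s : ℝ, ∀ᵐ t, HasDerivAt (fun t => Φ t s) (F t * Φ t s) t
  self : ∀ s : ℝ, Φ s s = 1

theorem intervalIntegrable_picard {R : Type*} [NormedRing R] {F g : ℝ → R} {C : ℝ} (hF : AEStronglyMeasurable F volume)
    (hC : ∀ t, ‖F t‖ ≤ C) (hg : Continuous g) (a b : ℝ) :
    IntervalIntegrable (fun τ => F τ * g τ) volume a b := by
  have h1 : IntervalIntegrable F volume a b := by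
    rw [intervalIntegrable_iff]
    refine Measure.integrableOn_of_bounded (M := C) (by simp) hF ?_
    exact Filter.Eventually.of_forall hC
  exact h1.mul_continuousOn hg.continuousOn

section StateTransition

variable {R : Type*} [NormedRing R] [NormedAlgebra ℝ R]

/-- One step of the Picard iteration for a linear equation with bounded coefficient. -/
theorem norm_picard_step_le {F g : ℝ → R} {C N s : ℝ} (hC : ∀ t, ‖F t‖ ≤ C) (k : ℕ) {T : ℝ}
    (hg : ∀ t ∈ uIcc s T, ‖g t‖ ≤ N * ((C * |t - s|) ^ k / (k.factorial : ℝ)))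
    {t : ℝ} (ht : t ∈ uIcc s T) :
    ‖∫ τ in s..t, F τ * g τ‖ ≤
      N * ((C * |t - s|) ^ (k + 1) / ((k + 1).factorial : ℝ)) := by
  have hC0 : 0 ≤ C := (norm_nonneg _).trans (hC 0)
  have h1 : ‖∫ τ in s..t, F τ * g τ‖ ≤
      ∫ τ in uIoc s t, C * (N * (C ^ k / (k.factorial : ℝ))) * |τ - s| ^ k := by
    rw [intervalIntegral.norm_intervalIntegral_eq]
    refine norm_integral_le_of_norm_le ?_ ?_
    · have : Continuous fun τ : ℝ => C * (N * (C ^ k / (k.factorial : ℝ))) * |τ - s| ^ k := by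
        fun_prop
      exact (this.intervalIntegrable s t).def'
    · refine (ae_restrict_iff' measurableSet_uIoc).2 (Filter.Eventually.of_forall fun τ hτ => ?_)
      have hτ' : τ ∈ uIcc s T :=
        (uIcc_subset_uIcc left_mem_uIcc ht) (uIoc_subset_uIcc hτ)
      calc ‖F τ * g τ‖ ≤ ‖F τ‖ * ‖g τ‖ := norm_mul_le _ _
        _ ≤ C * (N * ((C * |τ - s|) ^ k / (k.factorial : ℝ))) := by
            gcongr
            · exact hC τ
            · exact hg τ hτ'
        _ = _ := by rw [mul_pow]; ring
  refine h1.trans (le_of_eq ?_)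
  rw [integral_const_mul, integral_pow_abs_sub_uIoc, Nat.factorial_succ]
  have : (k.factorial : ℝ) ≠ 0 := by positivity
  push_cast
  rw [mul_pow, pow_succ C]
  field_simp

/-- The successive terms of the Picard iteration. -/
noncomputable def picardTerm (F : ℝ → R) (s : ℝ) : ℕ → ℝ → R
  | 0 => fun _ => 1
  | k + 1 => fun t => ∫ τ in s..t, F τ * picardTerm F s k τ

theorem continuous_picardTerm {F : ℝ → R} {C : ℝ} (hF : AEStronglyMeasurable F volume)
    (hC : ∀ t, ‖F t‖ ≤ C) (s : ℝ) (k : ℕ) : Continuous (picardTerm F s k) := by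
  induction k with
  | zero => exact continuous_const
  | succ k ih =>
    exact intervalIntegral.continuous_primitive
      (fun a b => intervalIntegrable_picard hF hC ih a b) s

theorem norm_picardTerm_le {F : ℝ → R} {C : ℝ}
    (hC : ∀ t, ‖F t‖ ≤ C) (s : ℝ) (k : ℕ) (t : ℝ) :
    ‖picardTerm F s k t‖ ≤ ‖(1 : R)‖ * ((C * |t - s|) ^ k / (k.factorial : ℝ)) := by
  induction k generalizing t with
  | zero => simp [picardTerm]
  | succ k ih => exact norm_picard_step_le hC k (T := t) (fun τ _ => ih τ) right_mem_uIcc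

/-- A linear equation with bounded measurable coefficient has a solution in integral form. -/
theorem exists_linear_integral_solution [CompleteSpace R] {F : ℝ → R} {C : ℝ}
    (hF : AEStronglyMeasurable F volume) (hC : ∀ t, ‖F t‖ ≤ C) (s : ℝ) :
    ∃ g : ℝ → R, Continuous g ∧ ∀ t, g t = 1 + ∫ τ in s..t, F τ * g τ := by
  have hC0 : 0 ≤ C := (norm_nonneg _).trans (hC 0)
  have hsum (x : ℝ) : Summable fun k : ℕ => ‖(1 : R)‖ * (x ^ k / (k.factorial : ℝ)) :=
    (Real.summable_pow_div_factorial x).mul_left _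
  have hP (t : ℝ) : Summable fun k => picardTerm F s k t :=
    Summable.of_norm_bounded (hsum (C * |t - s|)) fun k => norm_picardTerm_le hC s k t
  have hcont : Continuous fun t => ∑' k, picardTerm F s k t := by
    rw [continuous_iff_continuousAt]
    intro t
    have h1 : ContinuousOn (fun t => ∑' k, picardTerm F s k t) (Metric.ball s (|t - s| + 1)) := by
      refine continuousOn_tsum (fun k => (continuous_picardTerm hF hC s k).continuousOn)
        (hsum (C * (|t - s| + 1))) fun k x hx => ?_
      refine (norm_picardTerm_le hC s k x).trans ?_
      have : |x - s| ≤ |t - s| + 1 := (Metric.mem_ball.1 hx).le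
      gcongr
    refine h1.continuousAt (Metric.isOpen_ball.mem_nhds ?_)
    rw [Metric.mem_ball, Real.dist_eq]
    linarith
  refine ⟨fun t => ∑' k, picardTerm F s k t, hcont, fun t => ?_⟩
  have h2 : HasSum (fun k => ∫ τ in s..t, F τ * picardTerm F s k τ)
      (∫ τ in s..t, F τ * ∑' k, picardTerm F s k τ) := by
    refine intervalIntegral.hasSum_integral_of_dominated_convergence
      (fun k _ => C * (‖(1 : R)‖ * ((C * |t - s|) ^ k / (k.factorial : ℝ)))) ?_ ?_ ?_ ?_ ?_
    · intro k
      exact (hF.mul (continuous_picardTerm hF hC s k).aestronglyMeasurable).restrict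
    · intro k
      refine Filter.Eventually.of_forall fun τ hτ => ?_
      have hτ' : |τ - s| ≤ |t - s| := abs_sub_left_of_mem_uIcc (uIoc_subset_uIcc hτ)
      calc _ ≤ ‖F τ‖ * ‖picardTerm F s k τ‖ := norm_mul_le _ _
        _ ≤ C * (‖(1 : R)‖ * ((C * |τ - s|) ^ k / (k.factorial : ℝ))) := by
            gcongr
            · exact hC τ
            · exact norm_picardTerm_le hC s k τ
        _ ≤ _ := by gcongr
    · exact Filter.Eventually.of_forall fun _ _ => (hsum _).mul_left _
    · exact intervalIntegrable_const
    · exact Filter.Eventually.of_forall fun τ _ => (hP τ).hasSum.mul_left _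
  change ∑' k, picardTerm F s k t = _
  rw [(hP t).tsum_eq_zero_add, ← h2.tsum_eq]
  rfl

theorem eq_zero_of_linear_integral {F g : ℝ → R} {C s : ℝ} (hC : ∀ t, ‖F t‖ ≤ C)
    (hg : Continuous g) (h : ∀ t, g t = ∫ τ in s..t, F τ * g τ) : g = 0 := by
  funext T
  obtain ⟨N, hN⟩ := isCompact_uIcc.exists_bound_of_continuousOn (hg.continuousOn (s := uIcc s T))
  have key (k : ℕ) : ∀ t ∈ uIcc s T, ‖g t‖ ≤ N * ((C * |t - s|) ^ k / (k.factorial : ℝ)) := by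
    induction k with
    | zero => intro t ht; simpa using hN t ht
    | succ k ih =>
      intro t ht
      rw [h t]
      exact norm_picard_step_le hC k ih ht
  have hlim := (FloorSemiring.tendsto_pow_div_factorial_atTop (C * |T - s|)).const_mul N
  rw [mul_zero] at hlim
  exact norm_le_zero_iff.1 (ge_of_tendsto' hlim fun k => key k T right_mem_uIcc)

end StateTransition

/-- The state transition matrix of a bounded measurable coefficient exists and is unique. -/
theorem existsUnique_isStateTransitionMatrix {ι : Type*} [Fintype ι] [DecidableEq ι]
    {F : ℝ → Matrix ι ι ℝ} {C : ℝ} (hF : AEStronglyMeasurable F volume)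
    (hC : ∀ t, ‖F t‖ ≤ C) : ∃! Φ, IsStateTransitionMatrix F Φ := by
  have hint {g : ℝ → Matrix ι ι ℝ} (hg : Continuous g) (a b : ℝ) :
      IntervalIntegrable (fun τ => F τ * g τ) volume a b :=
    intervalIntegrable_picard hF hC hg a b
  have hder {g : ℝ → Matrix ι ι ℝ} (hg : Continuous g) (s : ℝ) :
      ∀ᵐ t, HasDerivAt (fun t => ∫ τ in s..t, F τ * g τ) (F t * g t) t := by
    have hF' : LocallyIntegrable (fun τ => F τ * g τ) volume := by
      intro x
      refine ⟨Icc (x - 1) (x + 1), Icc_mem_nhds (by linarith) (by linarith), ?_⟩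
      have := hint hg (x - 1) (x + 1)
      rwa [intervalIntegrable_iff_integrableOn_Icc_of_le (by linarith)] at this
    filter_upwards [_root_.LocallyIntegrable.ae_hasDerivAt_integral hF'] with t ht using ht s
  have hac {g : ℝ → Matrix ι ι ℝ} (hg : Continuous g) (s a b : ℝ) :
      AbsolutelyContinuousOnInterval (fun t => ∫ τ in s..t, F τ * g τ) a b := by
    have hC0 : 0 ≤ C := (norm_nonneg _).trans (hC 0)
    obtain ⟨N, hN⟩ := isCompact_uIcc.exists_bound_of_continuousOn (hg.continuousOn (s := uIcc a b))
    have hN0 : 0 ≤ N := (norm_nonneg _).trans (hN a left_mem_uIcc)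
    refine LipschitzOnWith.absolutelyContinuousOnInterval (K := ⟨C * N, by positivity⟩) ?_
    refine LipschitzOnWith.of_dist_le_mul fun x hx y hy => ?_
    rw [dist_eq_norm, intervalIntegral.integral_interval_sub_left (hint hg _ _) (hint hg _ _),
      Real.dist_eq]
    refine intervalIntegral.norm_integral_le_of_norm_le_const fun τ hτ => ?_
    have hτ' : τ ∈ uIcc a b := uIcc_subset_uIcc hy hx (uIoc_subset_uIcc hτ)
    calc _ ≤ ‖F τ‖ * ‖g τ‖ := norm_mul_le _ _
      _ ≤ C * N := by
        gcongr
        · exact hC τ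
        · exact hN τ hτ'
  have hconst (a b : ℝ) :
      AbsolutelyContinuousOnInterval (fun _ : ℝ => (1 : Matrix ι ι ℝ)) a b :=
    LipschitzOnWith.absolutelyContinuousOnInterval (K := 0)
      (LipschitzWith.const _).lipschitzOnWith
  choose G hGc hG using fun s => exists_linear_integral_solution hF hC s
  have hG' (s : ℝ) : G s = fun t => 1 + ∫ τ in s..t, F τ * G s τ := funext (hG s)
  refine ⟨fun t s => G s t, ⟨fun s a b => ?_, fun s => ?_, fun s => ?_⟩, fun Ψ hΨ => ?_⟩
  · have := (hconst a b).add (hac (hGc s) s a b)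
    change AbsolutelyContinuousOnInterval (G s) a b
    rw [hG' s]
    exact this
  · filter_upwards [hder (hGc s) s] with t ht
    have h1 := ht.const_add (1 : Matrix ι ι ℝ)
    rw [← hG' s] at h1
    exact h1
  · simp [hG s s]
  · funext t s
    have hcont : Continuous fun t => Ψ t s := by
      rw [continuous_iff_continuousAt]
      intro x
      refine (hΨ.absolutelyContinuous s (x - 1) (x + 1)).continuousOn.continuousAt ?_
      rw [uIcc_of_le (by linarith)]
      exact Icc_mem_nhds (by linarith) (by linarith)
    have hΨint (t : ℝ) : Ψ t s = 1 + ∫ τ in s..t, F τ * Ψ τ s := by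
      have h1 := (hΨ.absolutelyContinuous s s t).sub (hac hcont s s t)
      obtain ⟨c, hc⟩ := h1.const_of_ae_hasDerivAt_zero (by
        filter_upwards [hΨ.hasDerivAt s, hder hcont s] with τ h2 h3 _
        simpa using h2.sub h3)
      have hs := hc s left_mem_uIcc
      have ht := hc t right_mem_uIcc
      simp only [Pi.sub_apply, hΨ.self, intervalIntegral.integral_same, sub_zero] at hs ht
      rw [hs, ← ht]
      abel
    have h0 := eq_zero_of_linear_integral (F := F) (s := s) (g := fun t => Ψ t s - G s t) hC
      (hcont.sub (hGc s)) (fun t => by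
        simp only [mul_sub]
        rw [intervalIntegral.integral_sub (hint hcont _ _) (hint (hGc s) _ _), hΨint t, hG s t]
        abel)
    exact sub_eq_zero.1 (congrFun h0 t)

/-- For bounded measurable `W` the error dynamics have exactly one state transition matrix. -/
theorem existsUnique_errorDynamics {d q p : ℕ}
    (A : Matrix (Fin d) (Fin d) ℝ) (B : Matrix (Fin d) (Fin q) ℝ) (K : Matrix (Fin q) (Fin d) ℝ)
    (W : ℝ → Matrix (Fin q) (Fin p) ℝ) (hW : AEStronglyMeasurable W volume)
    (hbdd : ∃ C > (0 : ℝ), ∀ t : ℝ, ‖W t‖ < C) :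
    ∃! Φ, IsStateTransitionMatrix (errorDynamics A B K W) Φ := by
  obtain ⟨C, -, h⟩ := hbdd
  have hc : Continuous fun w : Matrix (Fin q) (Fin p) ℝ =>
      Matrix.fromBlocks (A + B * K) (B * w) 0 (-(wᵀ * w)) := by
    fun_prop
  obtain ⟨D, hD⟩ := (isCompact_closedBall (0 : Matrix (Fin q) (Fin p) ℝ) C
    ).exists_bound_of_continuousOn hc.continuousOn
  exact existsUnique_isStateTransitionMatrix (C := D) (hc.comp_aestronglyMeasurable hW)
    fun t => hD _ (by simpa using (h t).le)

/-!
The parameter error is a gradient flow `φ' = -P(t) φ` with `P = Wᵀ W` positive, so `‖φ‖²` decreases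
at the rate `2 ⟪P φ, φ⟫`. Over one excitation window, Cauchy–Schwarz bounds the distance from `φ` to
its initial value `φ₀` by the dissipated energy; since `∫ ⟪P φ₀, φ₀⟫` is at least a fixed multiple
of `‖φ₀‖²`, every window dissipates a fixed fraction of the energy, and `φ` decays exponentially.
The tracking error then solves a Hurwitz system whose forcing `B W φ` decays exponentially, because
`‖W‖ ≤ 1 + ‖Wᵀ W‖` has bounded integral over every window, and Duhamel's formula concludes.
-/

open Filter Topology

open scoped InnerProductSpace

theorem absolutelyContinuousOnInterval_prodMk {X Y : Type*} [PseudoMetricSpace X]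
    [PseudoMetricSpace Y] {a b : ℝ} {f : ℝ → X} {g : ℝ → Y}
    (hf : AbsolutelyContinuousOnInterval f a b) (hg : AbsolutelyContinuousOnInterval g a b) :
    AbsolutelyContinuousOnInterval (fun t => (f t, g t)) a b := by
  refine squeeze_zero (fun _ => Finset.sum_nonneg fun _ _ => dist_nonneg) (fun I => ?_)
    (by simpa using Tendsto.add hf hg)
  rw [← Finset.sum_add_distrib]
  exact Finset.sum_le_sum fun _ _ => max_le_add_of_nonneg dist_nonneg dist_nonneg

theorem absolutelyContinuousOnInterval_comp_of_locallyLipschitz {X Y : Type*}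
    [SeminormedAddCommGroup X] [PseudoMetricSpace Y] {G : X → Y} {f : ℝ → X} {a b : ℝ}
    (hG : LocallyLipschitz G) (hf : AbsolutelyContinuousOnInterval f a b) :
    AbsolutelyContinuousOnInterval (G ∘ f) a b := by
  obtain ⟨K, hK⟩ := (hG.locallyLipschitzOn (s := f '' uIcc a b)).exists_lipschitzOnWith_of_compact
    (isCompact_uIcc.image_of_continuousOn hf.continuousOn)
  have hlim := Tendsto.const_mul (K : ℝ) hf
  rw [mul_zero] at hlim
  refine squeeze_zero' (Eventually.of_forall fun _ => Finset.sum_nonneg fun _ _ => dist_nonneg)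
    (eventually_inf_principal.2 <| Eventually.of_forall fun I hI => ?_) hlim
  rw [Finset.mul_sum]
  exact Finset.sum_le_sum fun i hi => hK.dist_le_mul _ (mem_image_of_mem f (hI.1 i hi).1)
    _ (mem_image_of_mem f (hI.1 i hi).2)

/-- `f` is absolutely continuous on `[a, b]` with derivative `f'` almost everywhere there. This is
the sense in which a Carathéodory solution satisfies its differential equation. -/
structure HasACDerivOn {E : Type*} [NormedAddCommGroup E] [NormedSpace ℝ E] (f f' : ℝ → E)
    (a b : ℝ) : Prop where
  absolutelyContinuous : AbsolutelyContinuousOnInterval f a b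
  ae_hasDerivAt : ∀ᵐ t, t ∈ uIcc a b → HasDerivAt f (f' t) t

theorem sq_integral_le_integral_mul_integral {α : Type*} [MeasurableSpace α] {μ : Measure α}
    {g u v : α → ℝ} (hg : Integrable g μ) (hu : Integrable u μ) (hv : Integrable v μ)
    (hu₀ : 0 ≤ᵐ[μ] u) (hv₀ : 0 ≤ᵐ[μ] v) (h : ∀ᵐ x ∂μ, g x ^ 2 ≤ u x * v x) :
    (∫ x, g x ∂μ) ^ 2 ≤ (∫ x, u x ∂μ) * ∫ x, v x ∂μ := by
  have hquad (r : ℝ) :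
      0 ≤ (∫ x, u x ∂μ) * (r * r) + (2 * ∫ x, g x ∂μ) * r + ∫ x, v x ∂μ := by
    have hint : Integrable (fun x => u x * (r * r) + 2 * g x * r) μ :=
      (hu.mul_const _).add ((hg.const_mul 2).mul_const r)
    rw [← integral_mul_const, ← integral_const_mul, ← integral_mul_const,
      ← integral_add (hu.mul_const _) ((hg.const_mul 2).mul_const r), ← integral_add hint hv]
    refine integral_nonneg_of_ae ?_
    filter_upwards [hu₀, hv₀, h] with x hux hvx hx
    simp only [Pi.zero_apply] at hux hvx ⊢
    rcases hux.eq_or_lt' with hx0 | hpos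
    · have hgx : g x = 0 := by simpa [hx0, sq_nonpos_iff] using hx
      simpa [hx0, hgx] using hvx
    · refine nonneg_of_mul_nonneg_right (a := u x) ?_ hpos
      nlinarith [sq_nonneg (u x * r + g x)]
  have := discrim_le_zero hquad
  rw [discrim] at this
  linarith

namespace HasACDerivOn

variable {E F G : Type*} [NormedAddCommGroup E] [NormedSpace ℝ E]
  [NormedAddCommGroup F] [NormedSpace ℝ F] [NormedAddCommGroup G] [NormedSpace ℝ G]
  {f f' : ℝ → E} {g g' : ℝ → F} {a b c d : ℝ}

theorem mono (hf : HasACDerivOn f f' a b) (h : uIcc c d ⊆ uIcc a b) : HasACDerivOn f f' c d :=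
  ⟨hf.absolutelyContinuous.mono h, hf.ae_hasDerivAt.mono fun _ ht htc => ht (h htc)⟩

theorem of_contDiff (hf : ContDiff ℝ 1 f) (hf' : ∀ t, HasDerivAt f (f' t) t) :
    HasACDerivOn f f' a b :=
  ⟨hf.contDiffOn.absolutelyContinuousOnInterval, ae_of_all _ fun t _ => hf' t⟩

theorem prodMk (hf : HasACDerivOn f f' a b) (hg : HasACDerivOn g g' a b) :
    HasACDerivOn (fun t => (f t, g t)) (fun t => (f' t, g' t)) a b := by
  refine ⟨absolutelyContinuousOnInterval_prodMk hf.absolutelyContinuous hg.absolutelyContinuous, ?_⟩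
  filter_upwards [hf.ae_hasDerivAt, hg.ae_hasDerivAt] with t hft hgt ht
  exact (hft ht).prodMk (hgt ht)

theorem contDiff_comp {Ψ : E → F} {Ψ' : E → E →L[ℝ] F} (hΨ : ContDiff ℝ 1 Ψ)
    (hΨ' : ∀ x, HasFDerivAt Ψ (Ψ' x) x) (hf : HasACDerivOn f f' a b) :
    HasACDerivOn (fun t => Ψ (f t)) (fun t => Ψ' (f t) (f' t)) a b := by
  refine ⟨absolutelyContinuousOnInterval_comp_of_locallyLipschitz hΨ.locallyLipschitz
    hf.absolutelyContinuous, ?_⟩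
  filter_upwards [hf.ae_hasDerivAt] with t hft ht
  exact (hΨ' (f t)).comp_hasDerivAt t (hft ht)

theorem clm_comp (L : E →L[ℝ] F) (hf : HasACDerivOn f f' a b) :
    HasACDerivOn (fun t => L (f t)) (fun t => L (f' t)) a b :=
  hf.contDiff_comp L.contDiff fun _ => L.hasFDerivAt

theorem bilinear (B : E →L[ℝ] F →L[ℝ] G) (hf : HasACDerivOn f f' a b)
    (hg : HasACDerivOn g g' a b) :
    HasACDerivOn (fun t => B (f t) (g t)) (fun t => B (f t) (g' t) + B (f' t) (g t)) a b :=
  (hf.prodMk hg).contDiff_comp B.isBoundedBilinearMap.contDiff B.isBoundedBilinearMap.hasFDerivAt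

section Real

variable {f f' : ℝ → ℝ}

theorem deriv_ae_eq (hf : HasACDerivOn f f' a b) :
    deriv f =ᵐ[volume.restrict (uIoc a b)] f' := by
  refine (ae_restrict_iff' measurableSet_uIoc).2 ?_
  filter_upwards [hf.ae_hasDerivAt] with t hft ht
  exact (hft (uIoc_subset_uIcc ht)).deriv

theorem intervalIntegrable (hf : HasACDerivOn f f' a b) : IntervalIntegrable f' volume a b :=
  hf.absolutelyContinuous.intervalIntegrable_deriv.congr_ae hf.deriv_ae_eq

theorem integral_eq_sub (hf : HasACDerivOn f f' a b) : ∫ t in a..b, f' t = f b - f a := by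
  rw [← hf.absolutelyContinuous.integral_deriv_eq_sub]
  exact (intervalIntegral.integral_congr_ae_restrict hf.deriv_ae_eq).symm

end Real

theorem norm_sub_le_integral {β : ℝ → ℝ} (hab : a ≤ b) (hf : HasACDerivOn f f' a b)
    (hβ : IntervalIntegrable β volume a b) (hf' : ∀ t ∈ Icc a b, ‖f' t‖ ≤ β t) :
    ‖f b - f a‖ ≤ ∫ t in a..b, β t := by
  obtain ⟨ℓ, hℓ, hℓf⟩ := exists_dual_vector'' ℝ (f b - f a)
  have hℓint := hf.clm_comp ℓ
  calc ‖f b - f a‖ = ∫ t in a..b, ℓ (f' t) := by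
        rw [hℓint.integral_eq_sub, ← map_sub, hℓf]; rfl
    _ ≤ ∫ t in a..b, β t :=
        intervalIntegral.integral_mono_on hab hℓint.intervalIntegrable hβ fun t ht =>
          (le_abs_self _).trans <| (ℓ.le_of_opNorm_le hℓ _).trans <| by
            rw [one_mul]; exact hf' t ht

theorem sq_norm_sub_le_integral_mul_integral {u v : ℝ → ℝ} (hab : a ≤ b)
    (hf : HasACDerivOn f f' a b)
    (hu : IntervalIntegrable u volume a b) (hv : IntervalIntegrable v volume a b)
    (hu₀ : ∀ t ∈ Icc a b, 0 ≤ u t) (hv₀ : ∀ t ∈ Icc a b, 0 ≤ v t)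
    (hf' : ∀ t ∈ Icc a b, ‖f' t‖ ^ 2 ≤ u t * v t) :
    ‖f b - f a‖ ^ 2 ≤ (∫ t in a..b, u t) * ∫ t in a..b, v t := by
  obtain ⟨ℓ, hℓ, hℓf⟩ := exists_dual_vector'' ℝ (f b - f a)
  have hℓint := hf.clm_comp ℓ
  have hnorm : ‖f b - f a‖ = ∫ t in a..b, ℓ (f' t) := by
    rw [hℓint.integral_eq_sub, ← map_sub, hℓf]; rfl
  have hmem {p : ℝ → Prop} (hp : ∀ t ∈ Icc a b, p t) : ∀ᵐ t ∂volume.restrict (Ioc a b), p t :=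
    ae_restrict_of_forall_mem measurableSet_Ioc fun t ht => hp t (Ioc_subset_Icc_self ht)
  rw [hnorm]
  simp only [intervalIntegral.integral_of_le hab]
  refine sq_integral_le_integral_mul_integral hℓint.intervalIntegrable.1 hu.1 hv.1
    (hmem hu₀) (hmem hv₀) (hmem fun t ht => ?_)
  calc ℓ (f' t) ^ 2 = ‖ℓ (f' t)‖ ^ 2 := (Real.norm_eq_abs _ ▸ sq_abs _).symm
    _ ≤ ‖f' t‖ ^ 2 := by gcongr; simpa using ℓ.le_of_opNorm_le hℓ (f' t)
    _ ≤ u t * v t := hf' t ht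

end HasACDerivOn

theorem intervalIntegrable_of_windows {E : Type*} [NormedAddCommGroup E] {g : ℝ → E}
    {δ s t : ℝ} (hδ : 0 < δ) (hg : ∀ t₀ ≥ 0, IntervalIntegrable g volume t₀ (t₀ + δ))
    (hs : 0 ≤ s) (hst : s ≤ t) : IntervalIntegrable g volume s t := by
  obtain ⟨n, hn⟩ := exists_nat_ge ((t - s) / δ)
  have hwindow (k : ℕ) (_ : k < n) :
      IntervalIntegrable g volume (s + k * δ) (s + (k + 1 : ℕ) * δ) := by
    convert! hg (s + k * δ) (by positivity) using 1
    push_cast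
    ring
  have hall := IntervalIntegrable.trans_iterate hwindow
  rw [Nat.cast_zero, zero_mul, add_zero] at hall
  refine hall.mono_set (uIcc_subset_uIcc left_mem_uIcc (mem_uIcc_of_le hst ?_))
  linarith [(div_le_iff₀ hδ).1 hn]

theorem integral_le_of_windows {g : ℝ → ℝ} {δ K s t : ℝ} (hδ : 0 < δ) (hg₀ : ∀ t, 0 ≤ g t)
    (hg : ∀ t₀ ≥ 0, IntervalIntegrable g volume t₀ (t₀ + δ))
    (hK : ∀ t₀ ≥ 0, ∫ τ in t₀..(t₀ + δ), g τ ≤ K) (hs : 0 ≤ s) (hst : s ≤ t) :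
    ∫ τ in s..t, g τ ≤ K * ((t - s) / δ + 1) := by
  have hK₀ : 0 ≤ K := (intervalIntegral.integral_nonneg (by linarith) fun τ _ => hg₀ τ).trans
    (hK 0 le_rfl)
  set n := ⌈(t - s) / δ⌉₊
  have ht : t ≤ s + n * δ := by linarith [(div_le_iff₀ hδ).1 (Nat.le_ceil ((t - s) / δ))]
  have hnext (k : ℕ) : s + (k + 1 : ℕ) * δ = s + k * δ + δ := by push_cast; ring
  calc ∫ τ in s..t, g τ
      ≤ ∫ τ in s..(s + n * δ), g τ :=
        intervalIntegral.integral_mono_interval le_rfl hst ht (ae_of_all _ hg₀)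
          (intervalIntegrable_of_windows hδ hg hs (hst.trans ht))
    _ = ∑ k ∈ Finset.range n, ∫ τ in (s + k * δ)..(s + (k + 1 : ℕ) * δ), g τ := by
        rw [intervalIntegral.sum_integral_adjacent_intervals fun k _ => ?_]
        · simp only [Nat.cast_zero, zero_mul, add_zero]
        · rw [hnext]
          exact hg _ (by positivity)
    _ ≤ ∑ _k ∈ Finset.range n, K := Finset.sum_le_sum fun k _ => by
        rw [hnext]
        exact hK _ (by positivity)
    _ = K * n := by rw [Finset.sum_const, Finset.card_range, nsmul_eq_mul, mul_comm]
    _ ≤ K * ((t - s) / δ + 1) := by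
        gcongr
        exact (Nat.ceil_lt_add_one (div_nonneg (sub_nonneg.2 hst) hδ.le)).le

theorem le_exp_mul_of_le_on_windows {f : ℝ → ℝ} {s δ β D : ℝ} (hδ : 0 < δ) (hβ : 0 ≤ β)
    (hD : 0 ≤ D) (hfs : 0 ≤ f s) (hstep : ∀ t ≥ s, f (t + δ) ≤ Real.exp (-(β * δ)) * f t)
    (hlocal : ∀ u ≥ s, ∀ t ∈ Icc u (u + δ), f t ≤ D * f u) {t : ℝ} (hst : s ≤ t) :
    f t ≤ D * Real.exp (β * δ) * Real.exp (-(β * (t - s))) * f s := by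
  have hiterate (n : ℕ) : f (s + n * δ) ≤ Real.exp (-(β * (n * δ))) * f s := by
    induction n with
    | zero => simp
    | succ n ih =>
      calc f (s + (n + 1 : ℕ) * δ) = f (s + n * δ + δ) := by push_cast; ring_nf
        _ ≤ Real.exp (-(β * δ)) * f (s + n * δ) := hstep _ (by simpa using by positivity)
        _ ≤ Real.exp (-(β * δ)) * (Real.exp (-(β * (n * δ))) * f s) := by gcongr
        _ = Real.exp (-(β * ((n + 1 : ℕ) * δ))) * f s := by
            rw [← mul_assoc, ← Real.exp_add]; push_cast; ring_nf
  set n := ⌊(t - s) / δ⌋₊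
  have hn : n * δ ≤ t - s :=
    (le_div_iff₀ hδ).1 (Nat.floor_le (div_nonneg (sub_nonneg.2 hst) hδ.le))
  have hn' : t - s < (n + 1) * δ := (div_lt_iff₀ hδ).1 (Nat.lt_floor_add_one _)
  calc f t ≤ D * f (s + n * δ) :=
        hlocal _ (by simpa using by positivity) t ⟨by linarith, by linarith⟩
    _ ≤ D * (Real.exp (-(β * (n * δ))) * f s) := by gcongr; exact hiterate n
    _ ≤ D * (Real.exp (β * δ + -(β * (t - s))) * f s) := by gcongr; nlinarith
    _ = D * Real.exp (β * δ) * Real.exp (-(β * (t - s))) * f s := by rw [Real.exp_add]; ring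

theorem add_one_le_mul_exp {a c x : ℝ} (ha : 0 ≤ a) (hc : 0 < c) (hx : 0 ≤ x) :
    a * x + 1 ≤ (a / c + 1) * Real.exp (c * x) := by
  have hexp : c * x ≤ Real.exp (c * x) := (lt_add_one _).le.trans (Real.add_one_le_exp _)
  calc a * x + 1 = a / c * (c * x) + 1 := by field_simp
    _ ≤ a / c * Real.exp (c * x) + Real.exp (c * x) := by
        gcongr
        exact Real.one_le_exp (by positivity)
    _ = (a / c + 1) * Real.exp (c * x) := by ring

theorem integral_le_mul_exp_of_windows {g : ℝ → ℝ} {δ K γ s t : ℝ} (hδ : 0 < δ) (hγ : 0 < γ)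
    (hg₀ : ∀ t, 0 ≤ g t) (hg : ∀ t₀ ≥ 0, IntervalIntegrable g volume t₀ (t₀ + δ))
    (hK : ∀ t₀ ≥ 0, ∫ τ in t₀..(t₀ + δ), g τ ≤ K) (hs : 0 ≤ s) (hst : s ≤ t) :
    ∫ τ in s..t, g τ ≤ K * (δ⁻¹ / γ + 1) * Real.exp (γ * (t - s)) := by
  have hK₀ : 0 ≤ K := (intervalIntegral.integral_nonneg (by linarith) fun τ _ => hg₀ τ).trans
    (hK 0 le_rfl)
  calc ∫ τ in s..t, g τ ≤ K * (δ⁻¹ * (t - s) + 1) := by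
        rw [inv_mul_eq_div]
        exact integral_le_of_windows hδ hg₀ hg hK hs hst
    _ ≤ K * ((δ⁻¹ / γ + 1) * Real.exp (γ * (t - s))) := by
        gcongr
        exact add_one_le_mul_exp (by positivity) hγ (sub_nonneg.2 hst)
    _ = K * (δ⁻¹ / γ + 1) * Real.exp (γ * (t - s)) := by ring

theorem exp_mulVec_of_mulVec_eq_smul {𝕜 n : Type*} [RCLike 𝕜] [Fintype n] [DecidableEq n]
    {M : Matrix n n 𝕜} {z : 𝕜} {w : n → 𝕜} (hw : M *ᵥ w = z • w) :
    NormedSpace.exp M *ᵥ w = NormedSpace.exp z • w := by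
  have hpow (k : ℕ) : M ^ k *ᵥ w = z ^ k • w := by
    induction k with
    | zero => simp
    | succ k ih =>
      rw [pow_succ, ← Matrix.mulVec_mulVec, hw, Matrix.mulVec_smul, ih, smul_smul, ← pow_succ']
  have hM := (NormedSpace.exp_series_hasSum_exp' (𝕂 := 𝕜) M).map
    ((Matrix.mulVecBilin 𝕜 𝕜).flip w : Matrix n n 𝕜 →ₗ[𝕜] (n → 𝕜))
    (show Continuous fun A : Matrix n n 𝕜 => A *ᵥ w by fun_prop)
  have hz := (NormedSpace.exp_series_hasSum_exp' (𝕂 := 𝕜) z).smul_const w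
  refine hM.unique ?_
  convert! hz using 2 with k
  simp [hpow, smul_smul]

theorem exists_common_eigenvector_of_commute {K V : Type*} [Field K] [IsAlgClosed K]
    [AddCommGroup V] [Module K V] [FiniteDimensional K V] {f g : Module.End K V}
    (h : Commute f g) {μ : K} (hμ : f.HasEigenvalue μ) :
    ∃ (ν : K) (v : V), v ≠ 0 ∧ f v = μ • v ∧ g v = ν • v := by
  have : Nontrivial (f.eigenspace μ) := Submodule.nontrivial_iff_ne_bot.2 hμ
  obtain ⟨ν, hν⟩ := Module.End.exists_eigenvalue
    (g.restrict (Module.End.mapsTo_genEigenspace_of_comm h μ 1))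
  obtain ⟨⟨v, hv⟩, hgv⟩ := hν.exists_hasEigenvector
  exact ⟨ν, v, fun h => hgv.2 (Subtype.ext h), Module.End.mem_eigenspace_iff.1 hv,
    congrArg Subtype.val hgv.apply_eq_smul⟩

theorem spectrum_exp_subset {n : Type*} [Fintype n] [DecidableEq n] (M : Matrix n n ℂ) :
    spectrum ℂ (NormedSpace.exp M) ⊆ Complex.exp '' spectrum ℂ M := by
  intro l hl
  rw [← Matrix.spectrum_toLin', ← Module.End.hasEigenvalue_iff_mem_spectrum] at hl
  have hcomm : Commute (NormedSpace.exp M) M := (Commute.refl M).exp_left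
  obtain ⟨z, w, hw, hexp, hM⟩ :=
    exists_common_eigenvector_of_commute (hcomm.map Matrix.toLinAlgEquiv') hl
  refine ⟨z, ?_, ?_⟩
  · rw [← Matrix.spectrum_toLin', ← Module.End.hasEigenvalue_iff_mem_spectrum]
    exact Module.End.hasEigenvalue_of_hasEigenvector ⟨Module.End.mem_eigenspace_iff.2 hM, hw⟩
  · have : NormedSpace.exp z • w = l • w := (exp_mulVec_of_mulVec_eq_smul hM).symm.trans hexp
    rw [Complex.exp_eq_exp_ℂ]
    exact smul_left_injective ℂ hw this

theorem tendsto_pow_zero_of_spectralRadius_lt_one {R : Type*} [NormedRing R] [NormedAlgebra ℂ R]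
    [CompleteSpace R] {a : R} (ha : spectralRadius ℂ a < 1) :
    Tendsto (fun k : ℕ => a ^ k) atTop (𝓝 0) := by
  obtain ⟨r, hr, hr1⟩ := ENNReal.lt_iff_exists_nnreal_btwn.1 ha
  rw [ENNReal.coe_lt_one_iff] at hr1
  have hpow : ∀ᶠ k : ℕ in atTop, ‖a ^ k‖ ≤ (r : ℝ) ^ k := by
    filter_upwards [(spectrum.pow_nnnorm_pow_one_div_tendsto_nhds_spectralRadius
      a).eventually_lt_const hr, eventually_gt_atTop 0] with k hk hk0
    have hk' := ENNReal.rpow_le_rpow hk.le (z := (k : ℝ)) (by positivity)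
    rw [← ENNReal.rpow_mul, one_div, inv_mul_cancel₀ (by positivity), ENNReal.rpow_one,
      ENNReal.rpow_natCast] at hk'
    exact_mod_cast hk'
  exact squeeze_zero_norm' hpow (tendsto_pow_atTop_nhds_zero_of_lt_one r.2 hr1)

theorem exp_map_algebraMap_complex {n : Type*} [Fintype n] [DecidableEq n] (M : Matrix n n ℝ) :
    NormedSpace.exp (M.map (algebraMap ℝ ℂ)) = (NormedSpace.exp M).map (algebraMap ℝ ℂ) := by
  let := NormedAlgebra.restrictScalars ℚ ℝ (Matrix n n ℝ)
  let := NormedAlgebra.restrictScalars ℚ ℂ (Matrix n n ℂ)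
  exact (NormedSpace.map_exp (algebraMap ℝ ℂ).mapMatrix
    (continuous_id.matrix_map (continuous_algebraMap ℝ ℂ)) M).symm

theorem exists_norm_exp_smul_le_of_tendsto_pow {R : Type*} [NormedRing R] [NormedAlgebra ℝ R]
    [CompleteSpace R] {a : R} (ha : Tendsto (fun k : ℕ => NormedSpace.exp a ^ k) atTop (𝓝 0)) :
    ∃ C > (0 : ℝ), ∃ α > (0 : ℝ), ∀ t ≥ (0 : ℝ),
      ‖NormedSpace.exp (t • a)‖ ≤ C * Real.exp (-(α * t)) := by
  let := NormedAlgebra.restrictScalars ℚ ℝ R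
  have hadd (u v : ℝ) :
      NormedSpace.exp ((u + v) • a) = NormedSpace.exp (u • a) * NormedSpace.exp (v • a) := by
    rw [add_smul, NormedSpace.exp_add_of_commute]
    exact ((Commute.refl a).smul_left u).smul_right v
  obtain ⟨k, hk, hk₀⟩ := ((ha.norm.eventually_lt_const (u := Real.exp (-1))
    (by simpa using Real.exp_pos _)).and (eventually_gt_atTop 0)).exists
  have hk₀' : (0 : ℝ) < k := by exact_mod_cast hk₀
  obtain ⟨D, hD⟩ := (isCompact_Icc (a := (0 : ℝ)) (b := k)).exists_bound_of_continuousOn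
    (f := fun t : ℝ => NormedSpace.exp (t • a))
    (NormedSpace.exp_continuous.comp (by fun_prop)).continuousOn
  have hD₀ : 0 ≤ D := (norm_nonneg _).trans (hD 0 ⟨le_rfl, hk₀'.le⟩)
  refine ⟨D * Real.exp 1 * ‖(1 : R)‖ + 1, by positivity, 1 / k, by positivity, fun t ht => ?_⟩
  have hstep : ∀ t ≥ (0 : ℝ), ‖NormedSpace.exp ((t + k) • a)‖ ≤
      Real.exp (-(1 / k * k)) * ‖NormedSpace.exp (t • a)‖ := fun t _ => by
    rw [one_div_mul_cancel hk₀'.ne', add_comm, hadd, Nat.cast_smul_eq_nsmul, NormedSpace.exp_nsmul]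
    exact norm_mul_le_of_le hk.le le_rfl
  have hlocal : ∀ u ≥ (0 : ℝ), ∀ t ∈ Icc u (u + k),
      ‖NormedSpace.exp (t • a)‖ ≤ D * ‖NormedSpace.exp (u • a)‖ := fun u _ t ht => by
    rw [← sub_add_cancel t u, hadd]
    exact norm_mul_le_of_le (hD _ ⟨sub_nonneg.2 ht.1, sub_le_iff_le_add'.2 ht.2⟩) le_rfl
  have hdecay := le_exp_mul_of_le_on_windows (f := fun t => ‖NormedSpace.exp (t • a)‖)
    (β := 1 / k) hk₀' (by positivity) hD₀ (norm_nonneg _) hstep hlocal ht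
  rw [one_div_mul_cancel hk₀'.ne', zero_smul, NormedSpace.exp_zero, sub_zero] at hdecay
  linarith [Real.exp_pos (-(1 / k * t))]

namespace IsHurwitz

variable {n : Type*} [Fintype n] [DecidableEq n] {M : Matrix n n ℝ}

theorem spectralRadius_exp_lt_one (hM : IsHurwitz M) :
    spectralRadius ℂ (NormedSpace.exp (M.map (algebraMap ℝ ℂ))) < 1 := by
  rcases (spectrum ℂ (NormedSpace.exp (M.map (algebraMap ℝ ℂ)))).eq_empty_or_nonempty with h | h
  · rw [spectralRadius, h]
    simp
  · refine spectrum.spectralRadius_lt_of_forall_lt_of_nonempty h (r := 1) fun l hl => ?_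
    obtain ⟨z, hz, rfl⟩ := spectrum_exp_subset _ hl
    rw [← NNReal.coe_lt_coe, coe_nnnorm, Complex.norm_exp]
    simpa using hM z hz

theorem tendsto_exp_pow (hM : IsHurwitz M) :
    Tendsto (fun k : ℕ => NormedSpace.exp M ^ k) atTop (𝓝 0) := by
  have hre : Continuous fun A : Matrix n n ℂ => A.map Complex.re :=
    continuous_id.matrix_map Complex.continuous_re
  convert! (hre.tendsto 0).comp
    (tendsto_pow_zero_of_spectralRadius_lt_one hM.spectralRadius_exp_lt_one) using 2 with k
  rw [Function.comp_apply, exp_map_algebraMap_complex, ← RingHom.mapMatrix_apply, ← map_pow]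
  ext i j
  simp

theorem exists_norm_exp_smul_le (hM : IsHurwitz M) :
    ∃ C > (0 : ℝ), ∃ α > (0 : ℝ), ∀ t ≥ (0 : ℝ),
      ‖NormedSpace.exp (t • M)‖ ≤ C * Real.exp (-(α * t)) :=
  exists_norm_exp_smul_le_of_tendsto_pow hM.tendsto_exp_pow

end IsHurwitz

section Excitation

variable {E : Type*} [NormedAddCommGroup E] [InnerProductSpace ℝ E]

theorem sq_inner_apply_le_of_isPositive {T : E →L[ℝ] E} (hT : T.IsPositive) (x y : E) :
    ⟪T x, y⟫_ℝ ^ 2 ≤ ⟪T x, x⟫_ℝ * ⟪T y, y⟫_ℝ := by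
  let B : LinearMap.BilinForm ℝ E := (innerₗ E).comp T.toLinearMap
  refine B.apply_sq_le_of_symm hT.inner_nonneg_left ⟨fun x y => ?_⟩ x y
  exact (hT.inner_left_eq_inner_right x y).trans (real_inner_comm _ _)

theorem inner_apply_self_le_opNorm_mul_sq_norm (T : E →L[ℝ] E) (x : E) :
    ⟪T x, x⟫_ℝ ≤ ‖T‖ * ‖x‖ ^ 2 := by
  rw [sq, ← mul_assoc]
  exact (real_inner_le_norm _ _).trans (by gcongr; exact T.le_opNorm x)

theorem sq_norm_apply_le_of_isPositive {T : E →L[ℝ] E} (hT : T.IsPositive) (x : E) :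
    ‖T x‖ ^ 2 ≤ ‖T‖ * ⟪T x, x⟫_ℝ := by
  rcases (norm_nonneg (T x)).eq_or_lt with h | h
  · rw [← h, zero_pow two_ne_zero]
    exact mul_nonneg (norm_nonneg T) (hT.inner_nonneg_left x)
  · refine le_of_mul_le_mul_right ?_ (pow_pos h 2)
    calc ‖T x‖ ^ 2 * ‖T x‖ ^ 2 = ⟪T x, T x⟫_ℝ ^ 2 := by rw [real_inner_self_eq_norm_sq]; ring
      _ ≤ ⟪T x, x⟫_ℝ * ⟪T (T x), T x⟫_ℝ := sq_inner_apply_le_of_isPositive hT x (T x)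
      _ ≤ ⟪T x, x⟫_ℝ * (‖T‖ * ‖T x‖ ^ 2) := by
          gcongr
          · exact hT.inner_nonneg_left x
          · exact inner_apply_self_le_opNorm_mul_sq_norm T (T x)
      _ = ‖T‖ * ⟪T x, x⟫_ℝ * ‖T x‖ ^ 2 := by ring

theorem inner_apply_self_le_two_mul_add {T : E →L[ℝ] E} (hT : T.IsPositive) (x y : E) :
    ⟪T x, x⟫_ℝ ≤ 2 * ⟪T y, y⟫_ℝ + 2 * ⟪T (y - x), y - x⟫_ℝ := by
  have : ⟪T x, y⟫_ℝ = ⟪T y, x⟫_ℝ :=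
    (hT.inner_left_eq_inner_right x y).trans (real_inner_comm _ _)
  have hpos := hT.inner_nonneg_left (y + (y - x))
  simp only [map_sub, map_add, inner_sub_left, inner_sub_right, inner_add_left,
    inner_add_right] at hpos ⊢
  linarith

theorem HasACDerivOn.norm_sq {f f' : ℝ → E} {a b : ℝ} (hf : HasACDerivOn f f' a b) :
    HasACDerivOn (fun t => ‖f t‖ ^ 2) (fun t => 2 * ⟪f t, f' t⟫_ℝ) a b := by
  convert! hf.contDiff_comp (contDiff_id.norm_sq ℝ)
    fun x => (hasStrictFDerivAt_norm_sq x).hasFDerivAt using 2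
  simp

section GradientFlow

variable {P : ℝ → E →L[ℝ] E} {φ : ℝ → E} {a b c C δ : ℝ}

theorem hasACDerivOn_energy (hφ : HasACDerivOn φ (fun t => -(P t (φ t))) a b) :
    HasACDerivOn (fun t => ‖φ t‖ ^ 2) (fun t => -2 * ⟪P t (φ t), φ t⟫_ℝ) a b := by
  convert! hφ.norm_sq using 2 with t
  rw [inner_neg_right, real_inner_comm]
  ring

theorem intervalIntegrable_dissipation (hφ : HasACDerivOn φ (fun t => -(P t (φ t))) a b) :
    IntervalIntegrable (fun t => ⟪P t (φ t), φ t⟫_ℝ) volume a b := by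
  simpa using (hasACDerivOn_energy hφ).intervalIntegrable.const_mul (-2)⁻¹

theorem sq_norm_eq_sub_dissipation (hφ : HasACDerivOn φ (fun t => -(P t (φ t))) a b) :
    ‖φ b‖ ^ 2 = ‖φ a‖ ^ 2 - 2 * ∫ t in a..b, ⟪P t (φ t), φ t⟫_ℝ := by
  have := (hasACDerivOn_energy hφ).integral_eq_sub
  rw [intervalIntegral.integral_const_mul] at this
  linarith

theorem norm_le_of_gradientFlow (hab : a ≤ b) (hP : ∀ t, (P t).IsPositive)
    (hφ : HasACDerivOn φ (fun t => -(P t (φ t))) a b) : ‖φ b‖ ≤ ‖φ a‖ := by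
  have := intervalIntegral.integral_nonneg (μ := volume) hab
    fun t _ => (hP t).inner_nonneg_left (φ t)
  refine le_of_sq_le_sq ?_ (norm_nonneg _)
  linarith [sq_norm_eq_sub_dissipation hφ]

theorem sq_norm_sub_le_dissipation (hP : ∀ t, (P t).IsPositive)
    (hPint : IntervalIntegrable P volume a b)
    (hφ : HasACDerivOn φ (fun t => -(P t (φ t))) a b) {t : ℝ} (ht : t ∈ Icc a b) :
    ‖φ t - φ a‖ ^ 2 ≤ (∫ τ in a..b, ‖P τ‖) * ∫ τ in a..b, ⟪P τ (φ τ), φ τ⟫_ℝ := by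
  have hsub : uIcc a t ⊆ uIcc a b := uIcc_subset_uIcc left_mem_uIcc (mem_uIcc_of_le ht.1 ht.2)
  have hdiss₀ (τ : ℝ) : 0 ≤ ⟪P τ (φ τ), φ τ⟫_ℝ := (hP τ).inner_nonneg_left _
  have hdiss := intervalIntegrable_dissipation hφ
  calc ‖φ t - φ a‖ ^ 2
      ≤ (∫ τ in a..t, ‖P τ‖) * ∫ τ in a..t, ⟪P τ (φ τ), φ τ⟫_ℝ :=
        (hφ.mono hsub).sq_norm_sub_le_integral_mul_integral ht.1
          (hPint.norm.mono_set hsub) (hdiss.mono_set hsub) (fun _ _ => norm_nonneg _)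
          (fun τ _ => hdiss₀ τ)
          fun τ _ => by rw [norm_neg]; exact sq_norm_apply_le_of_isPositive (hP τ) (φ τ)
    _ ≤ (∫ τ in a..b, ‖P τ‖) * ∫ τ in a..b, ⟪P τ (φ τ), φ τ⟫_ℝ := by
        gcongr
        · exact intervalIntegral.integral_nonneg ht.1 fun τ _ => hdiss₀ τ
        · exact intervalIntegral.integral_nonneg (ht.1.trans ht.2) fun τ _ => norm_nonneg _
        · exact intervalIntegral.integral_mono_interval le_rfl ht.1 ht.2
            (ae_of_all _ fun τ => norm_nonneg _) hPint.norm
        · exact intervalIntegral.integral_mono_interval le_rfl ht.1 ht.2 (ae_of_all _ hdiss₀) hdiss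

theorem intervalIntegrable_inner_apply (hPint : IntervalIntegrable P volume a b) (v : E) :
    IntervalIntegrable (fun t => ⟪P t v, v⟫_ℝ) volume a b := by
  let L : (E →L[ℝ] E) →L[ℝ] ℝ := (innerSLFlip ℝ v).comp (ContinuousLinearMap.apply ℝ E v)
  exact ⟨L.integrable_comp hPint.1, L.integrable_comp hPint.2⟩

theorem integral_inner_initial_le_dissipation (hab : a ≤ b) (hP : ∀ t, (P t).IsPositive)
    (hPint : IntervalIntegrable P volume a b) (hC : ∫ t in a..b, ‖P t‖ ≤ C)
    (hφ : HasACDerivOn φ (fun t => -(P t (φ t))) a b) :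
    ∫ t in a..b, ⟪P t (φ a), φ a⟫_ℝ ≤ 2 * (1 + C ^ 2) * ∫ t in a..b, ⟪P t (φ t), φ t⟫_ℝ := by
  set J := ∫ t in a..b, ⟪P t (φ t), φ t⟫_ℝ
  set N := ∫ t in a..b, ‖P t‖
  have hJ : 0 ≤ J := intervalIntegral.integral_nonneg hab fun t _ => (hP t).inner_nonneg_left _
  have hN : 0 ≤ N := intervalIntegral.integral_nonneg hab fun t _ => norm_nonneg _
  have hdiss := intervalIntegrable_dissipation hφ
  have hinit := intervalIntegrable_inner_apply hPint (φ a)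
  calc ∫ t in a..b, ⟪P t (φ a), φ a⟫_ℝ
      ≤ ∫ t in a..b, (2 * ⟪P t (φ t), φ t⟫_ℝ + 2 * (N * J) * ‖P t‖) := by
        refine intervalIntegral.integral_mono_on hab hinit
          ((hdiss.const_mul 2).add (hPint.norm.const_mul _)) fun t ht => ?_
        calc ⟪P t (φ a), φ a⟫_ℝ
            ≤ 2 * ⟪P t (φ t), φ t⟫_ℝ + 2 * ⟪P t (φ t - φ a), φ t - φ a⟫_ℝ :=
              inner_apply_self_le_two_mul_add (hP t) _ _
          _ ≤ 2 * ⟪P t (φ t), φ t⟫_ℝ + 2 * (‖P t‖ * (N * J)) := by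
              gcongr
              refine (inner_apply_self_le_opNorm_mul_sq_norm _ _).trans ?_
              gcongr
              exact sq_norm_sub_le_dissipation hP hPint hφ ht
          _ = 2 * ⟪P t (φ t), φ t⟫_ℝ + 2 * (N * J) * ‖P t‖ := by ring
    _ = 2 * (1 + N ^ 2) * J := by
        rw [intervalIntegral.integral_add (hdiss.const_mul 2) (hPint.norm.const_mul _),
          intervalIntegral.integral_const_mul, intervalIntegral.integral_const_mul]
        ring
    _ ≤ 2 * (1 + C ^ 2) * J := by gcongr

theorem sq_norm_le_of_excitation (hab : a ≤ b) (hP : ∀ t, (P t).IsPositive)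
    (hPint : IntervalIntegrable P volume a b) (hC : ∫ t in a..b, ‖P t‖ ≤ C)
    (hc : c * ‖φ a‖ ^ 2 ≤ ∫ t in a..b, ⟪P t (φ a), φ a⟫_ℝ)
    (hφ : HasACDerivOn φ (fun t => -(P t (φ t))) a b) :
    ‖φ b‖ ^ 2 ≤ (1 - c / (1 + C ^ 2)) * ‖φ a‖ ^ 2 := by
  have hdiss : c / (1 + C ^ 2) * ‖φ a‖ ^ 2 ≤ 2 * ∫ t in a..b, ⟪P t (φ t), φ t⟫_ℝ := by
    rw [div_mul_eq_mul_div, div_le_iff₀ (by positivity)]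
    linarith [integral_inner_initial_le_dissipation hab hP hPint hC hφ]
  linarith [sq_norm_eq_sub_dissipation hφ]

end GradientFlow

/-- Persistence of excitation for a time-dependent positive operator `P`: on every window
`[t₀, t₀ + δ]` in the half-line `t₀ ≥ 0`, the quadratic form of `P` integrates to at least `c` and
the norm of `P` to at most `C`. -/
structure UniformlyExciting (P : ℝ → E →L[ℝ] E) (δ c C : ℝ) : Prop where
  isPositive : ∀ t, (P t).IsPositive
  intervalIntegrable : ∀ t₀ ≥ 0, IntervalIntegrable P volume t₀ (t₀ + δ)
  integral_norm_le : ∀ t₀ ≥ 0, ∫ t in t₀..(t₀ + δ), ‖P t‖ ≤ C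
  le_integral_inner : ∀ t₀ ≥ 0, ∀ v : E, c * ‖v‖ ^ 2 ≤ ∫ t in t₀..(t₀ + δ), ⟪P t v, v⟫_ℝ

theorem UniformlyExciting.norm_le_exp_mul {P : ℝ → E →L[ℝ] E} {δ c C : ℝ} (hδ : 0 < δ)
    (hc : 0 ≤ c) (hP : UniformlyExciting P δ c C) {φ : ℝ → E} {s t : ℝ} (hs : 0 ≤ s) (hst : s ≤ t)
    (hφ : ∀ u v, HasACDerivOn φ (fun t => -(P t (φ t))) u v) :
    ‖φ t‖ ≤ Real.exp (c / (1 + C ^ 2) / 2) *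
      Real.exp (-(c / (1 + C ^ 2) / (2 * δ) * (t - s))) * ‖φ s‖ := by
  set ε := c / (1 + C ^ 2)
  have hstep : ∀ t ≥ s, ‖φ (t + δ)‖ ^ 2 ≤ Real.exp (-(ε / δ * δ)) * ‖φ t‖ ^ 2 := fun t ht => by
    have ht₀ := hs.trans ht
    rw [div_mul_cancel₀ _ hδ.ne']
    exact (sq_norm_le_of_excitation (by linarith) hP.isPositive (hP.intervalIntegrable t ht₀)
      (hP.integral_norm_le t ht₀) (hP.le_integral_inner t ht₀ _) (hφ _ _)).trans
      (by gcongr; exact Real.one_sub_le_exp_neg ε)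
  have hlocal : ∀ u ≥ s, ∀ t ∈ Icc u (u + δ), ‖φ t‖ ^ 2 ≤ 1 * ‖φ u‖ ^ 2 := fun u _ t ht => by
    rw [one_mul]
    gcongr
    exact norm_le_of_gradientFlow ht.1 hP.isPositive (hφ _ _)
  have hsq := le_exp_mul_of_le_on_windows (f := fun t => ‖φ t‖ ^ 2) (β := ε / δ) hδ
    (by positivity) zero_le_one (sq_nonneg _) hstep hlocal hst
  refine le_of_sq_le_sq (hsq.trans_eq ?_) (by positivity)
  rw [div_mul_cancel₀ _ hδ.ne', one_mul, mul_pow, mul_pow, ← Real.exp_nat_mul, ← Real.exp_nat_mul,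
    Nat.cast_ofNat]
  congr 3 <;> field_simp

end Excitation

section Cascade

variable {E F : Type*} [NormedAddCommGroup E] [NormedSpace ℝ E] [CompleteSpace E]

theorem hasACDerivOn_exp_sub_smul (H : E →L[ℝ] E) (a b t : ℝ) :
    HasACDerivOn (fun τ : ℝ => NormedSpace.exp ((t - τ) • H))
      (fun τ => -(NormedSpace.exp ((t - τ) • H) * H)) a b := by
  have hderiv (τ : ℝ) : HasDerivAt (fun τ : ℝ => NormedSpace.exp ((t - τ) • H))
      (-(NormedSpace.exp ((t - τ) • H) * H)) τ := by
    have hcomp := (hasDerivAt_exp_smul_const H (t - τ)).scomp τ ((hasDerivAt_id τ).const_sub t)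
    rwa [neg_smul, one_smul] at hcomp
  refine .of_contDiff (contDiff_one_iff_deriv.2 ⟨fun τ => (hderiv τ).differentiableAt, ?_⟩) hderiv
  rw [funext fun τ => (hderiv τ).deriv]
  have : Continuous fun τ : ℝ => NormedSpace.exp ((t - τ) • H) :=
    continuous_iff_continuousAt.2 fun τ => (hderiv τ).continuousAt
  fun_prop

theorem hasACDerivOn_exp_sub_smul_apply {H : E →L[ℝ] E} {e h : ℝ → E} {a b : ℝ}
    (he : HasACDerivOn e (fun t => H (e t) + h t) a b) (t : ℝ) :
    HasACDerivOn (fun τ => NormedSpace.exp ((t - τ) • H) (e τ))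
      (fun τ => NormedSpace.exp ((t - τ) • H) (h τ)) a b := by
  convert! (hasACDerivOn_exp_sub_smul H a b t).bilinear (.id ℝ (E →L[ℝ] E)) he using 2
  simp

theorem norm_le_exp_mul_of_forcing {H : E →L[ℝ] E} {C γ : ℝ}
    (hH : ∀ t ≥ (0 : ℝ), ‖NormedSpace.exp (t • H)‖ ≤ C * Real.exp (-(γ * t)))
    {e h : ℝ → E} {b : ℝ → ℝ} {s t : ℝ} (hst : s ≤ t)
    (he : HasACDerivOn e (fun t => H (e t) + h t) s t) (hb : IntervalIntegrable b volume s t)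
    (hh : ∀ τ ∈ Icc s t, ‖h τ‖ ≤ b τ * Real.exp (-(γ * (τ - s)))) :
    ‖e t‖ ≤ C * Real.exp (-(γ * (t - s))) * (‖e s‖ + ∫ τ in s..t, b τ) := by
  have hforced : ‖e t - NormedSpace.exp ((t - s) • H) (e s)‖ ≤
      ∫ τ in s..t, C * Real.exp (-(γ * (t - s))) * b τ := by
    have := (hasACDerivOn_exp_sub_smul_apply he t).norm_sub_le_integral hst
      (hb.const_mul (C * Real.exp (-(γ * (t - s))))) fun τ hτ => ?_
    · simpa using this
    · calc ‖NormedSpace.exp ((t - τ) • H) (h τ)‖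
          ≤ C * Real.exp (-(γ * (t - τ))) * (b τ * Real.exp (-(γ * (τ - s)))) :=
            ContinuousLinearMap.le_of_opNorm_le_of_le _ (hH _ (sub_nonneg.2 hτ.2)) (hh τ hτ)
        _ = C * (Real.exp (-(γ * (t - τ))) * Real.exp (-(γ * (τ - s)))) * b τ := by ring
        _ = C * Real.exp (-(γ * (t - s))) * b τ := by rw [← Real.exp_add]; ring_nf
  rw [intervalIntegral.integral_const_mul] at hforced
  calc ‖e t‖ ≤ ‖NormedSpace.exp ((t - s) • H) (e s)‖ +
        ‖e t - NormedSpace.exp ((t - s) • H) (e s)‖ := norm_le_norm_add_norm_sub' _ _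
    _ ≤ C * Real.exp (-(γ * (t - s))) * ‖e s‖ +
        C * Real.exp (-(γ * (t - s))) * ∫ τ in s..t, b τ := by
        gcongr
        exact ContinuousLinearMap.le_of_opNorm_le _ (hH _ (sub_nonneg.2 hst)) _
    _ = C * Real.exp (-(γ * (t - s))) * (‖e s‖ + ∫ τ in s..t, b τ) := by ring

variable [NormedAddCommGroup F] [InnerProductSpace ℝ F] {P : ℝ → F →L[ℝ] F} {G : ℝ → F →L[ℝ] E}
  {H : E →L[ℝ] E} {β : ℝ → ℝ} {δ c C K : ℝ}

theorem norm_le_of_decaying_coupling {γ D : ℝ} (hδ : 0 < δ) (hγ : 0 < γ)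
    (hH : ∀ t ≥ (0 : ℝ), ‖NormedSpace.exp (t • H)‖ ≤ C * Real.exp (-(γ * t)))
    (hG : ∀ t, ‖G t‖ ≤ β t) (hβ : ∀ t₀ ≥ 0, IntervalIntegrable β volume t₀ (t₀ + δ))
    (hK : ∀ t₀ ≥ 0, ∫ t in t₀..(t₀ + δ), β t ≤ K) {e : ℝ → E} {φ : ℝ → F} {s t : ℝ}
    (hs : 0 ≤ s) (hst : s ≤ t) (he : HasACDerivOn e (fun t => H (e t) + G t (φ t)) s t)
    (hφ : ∀ τ ∈ Icc s t, ‖φ τ‖ ≤ D * Real.exp (-(γ * (τ - s))) * ‖φ s‖) :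
    ‖e t‖ ≤ C * Real.exp (-(γ / 2 * (t - s))) *
      (‖e s‖ + K * (δ⁻¹ / (γ / 2) + 1) * D * ‖φ s‖) := by
  have hC : 0 ≤ C := by simpa using (norm_nonneg _).trans (hH 0 le_rfl)
  have hD : 0 ≤ D * ‖φ s‖ := by
    simpa using (norm_nonneg _).trans (hφ s (left_mem_Icc.2 hst))
  have hβ₀ (τ : ℝ) : 0 ≤ β τ := (norm_nonneg _).trans (hG τ)
  have hforced := norm_le_exp_mul_of_forcing hH hst he
    ((intervalIntegrable_of_windows hδ hβ hs hst).mul_const (D * ‖φ s‖)) fun τ hτ =>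
      calc ‖G τ (φ τ)‖ ≤ β τ * (D * Real.exp (-(γ * (τ - s))) * ‖φ s‖) :=
            ContinuousLinearMap.le_of_opNorm_le_of_le _ (hG τ) (hφ τ hτ)
        _ = β τ * (D * ‖φ s‖) * Real.exp (-(γ * (τ - s))) := by ring
  rw [intervalIntegral.integral_mul_const] at hforced
  have hgrowth : 1 ≤ Real.exp (γ / 2 * (t - s)) :=
    Real.one_le_exp (mul_nonneg (by positivity) (sub_nonneg.2 hst))
  have hsplit : Real.exp (-(γ * (t - s))) * Real.exp (γ / 2 * (t - s)) =
      Real.exp (-(γ / 2 * (t - s))) := by rw [← Real.exp_add]; ring_nf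
  calc ‖e t‖ ≤ C * Real.exp (-(γ * (t - s))) * (‖e s‖ * Real.exp (γ / 2 * (t - s)) +
        K * (δ⁻¹ / (γ / 2) + 1) * Real.exp (γ / 2 * (t - s)) * (D * ‖φ s‖)) := by
        refine hforced.trans ?_
        gcongr
        · exact le_mul_of_one_le_right (norm_nonneg _) hgrowth
        · exact integral_le_mul_exp_of_windows hδ (half_pos hγ) hβ₀ hβ hK hs hst
    _ = C * Real.exp (-(γ / 2 * (t - s))) *
        (‖e s‖ + K * (δ⁻¹ / (γ / 2) + 1) * D * ‖φ s‖) := by rw [← hsplit]; ring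

theorem exists_norm_le_of_cascade (hδ : 0 < δ) (hc : 0 < c) (hP : UniformlyExciting P δ c C)
    (hH : ∃ C > (0 : ℝ), ∃ α > (0 : ℝ), ∀ t ≥ (0 : ℝ),
      ‖NormedSpace.exp (t • H)‖ ≤ C * Real.exp (-(α * t)))
    (hG : ∀ t, ‖G t‖ ≤ β t) (hβ : ∀ t₀ ≥ 0, IntervalIntegrable β volume t₀ (t₀ + δ))
    (hK : ∀ t₀ ≥ 0, ∫ t in t₀..(t₀ + δ), β t ≤ K) :
    ∃ M > (0 : ℝ), ∃ ζ > (0 : ℝ), ∀ (e : ℝ → E) (φ : ℝ → F) (s t : ℝ), 0 ≤ s → s ≤ t →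
      (∀ a b, HasACDerivOn e (fun t => H (e t) + G t (φ t)) a b) →
      (∀ a b, HasACDerivOn φ (fun t => -(P t (φ t))) a b) →
      ‖e t‖ + ‖φ t‖ ≤ M * Real.exp (-(ζ * (t - s))) * (‖e s‖ + ‖φ s‖) := by
  obtain ⟨C₁, hC₁, α, hα, hexp⟩ := hH
  set ε := c / (1 + C ^ 2)
  set D := Real.exp (ε / 2)
  set γ := min α (ε / (2 * δ))
  have hγ : 0 < γ := lt_min hα (by positivity)
  have : 0 < D := Real.exp_pos _
  have hK₀ : 0 ≤ K := (intervalIntegral.integral_nonneg (by linarith) fun τ _ =>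
    (norm_nonneg _).trans (hG τ)).trans (hK 0 le_rfl)
  set L := K * (δ⁻¹ / (γ / 2) + 1)
  have : 0 ≤ L := by positivity
  refine ⟨C₁ + C₁ * L * D + D, by positivity, γ / 2, by positivity, fun e φ s t hs hst he hφ => ?_⟩
  have hφdecay (τ : ℝ) (hτ : s ≤ τ) : ‖φ τ‖ ≤ D * Real.exp (-(γ * (τ - s))) * ‖φ s‖ :=
    (hP.norm_le_exp_mul hδ hc.le hs hτ hφ).trans (by gcongr; exact min_le_right _ _)
  have hedecay := norm_le_of_decaying_coupling hδ hγ (fun t ht => (hexp t ht).trans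
    (by gcongr; exact min_le_left _ _)) hG hβ hK hs hst (he s t) fun τ hτ => hφdecay τ hτ.1
  set X := Real.exp (-(γ / 2 * (t - s)))
  calc ‖e t‖ + ‖φ t‖ ≤ C₁ * X * (‖e s‖ + L * D * ‖φ s‖) + D * X * ‖φ s‖ := by
        refine add_le_add hedecay ((hφdecay t hst).trans ?_)
        gcongr
        refine Real.exp_le_exp.2 (neg_le_neg ?_)
        gcongr
        exact half_le_self hγ.le
    _ ≤ C₁ * X * (‖e s‖ + L * D * ‖φ s‖) + D * X * ‖φ s‖ +
        X * ((C₁ * L * D + D) * ‖e s‖ + C₁ * ‖φ s‖) := le_add_of_nonneg_right (by positivity)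
    _ = (C₁ + C₁ * L * D + D) * X * (‖e s‖ + ‖φ s‖) := by ring

end Cascade

section FiniteDimensional

variable {E : Type*} [NormedAddCommGroup E] [InnerProductSpace ℝ E]

theorem opNorm_le_sum_inner_of_isPositive {ι : Type*} [Fintype ι] {T : E →L[ℝ] E}
    (hT : T.IsPositive) (b : OrthonormalBasis ι ℝ E) : ‖T‖ ≤ ∑ i, ⟪T (b i), b i⟫_ℝ := by
  have htrace : 0 ≤ ∑ i, ⟪T (b i), b i⟫_ℝ := Finset.sum_nonneg fun i _ => hT.inner_nonneg_left _
  refine T.opNorm_le_bound htrace fun x => ?_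
  rcases (norm_nonneg (T x)).eq_or_lt with h | h
  · rw [← h]
    positivity
  · refine le_of_mul_le_mul_right ?_ h
    calc ‖T x‖ * ‖T x‖ = ∑ i, ⟪T x, b i⟫_ℝ ^ 2 := by rw [b.sum_sq_inner_left, sq]
      _ ≤ ∑ i, ⟪T x, x⟫_ℝ * ⟪T (b i), b i⟫_ℝ :=
          Finset.sum_le_sum fun i _ => sq_inner_apply_le_of_isPositive hT x (b i)
      _ = (∑ i, ⟪T (b i), b i⟫_ℝ) * ⟪T x, x⟫_ℝ := by rw [← Finset.mul_sum, mul_comm]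
      _ ≤ (∑ i, ⟪T (b i), b i⟫_ℝ) * (‖T x‖ * ‖x‖) := by
          gcongr
          exact real_inner_le_norm _ _
      _ = (∑ i, ⟪T (b i), b i⟫_ℝ) * ‖x‖ * ‖T x‖ := by ring

theorem UniformlyExciting.of_integral_inner_le {ι : Type*} [Fintype ι] (b : OrthonormalBasis ι ℝ E)
    {P : ℝ → E →L[ℝ] E} {δ c C : ℝ} (hδ : 0 ≤ δ) (hP : ∀ t, (P t).IsPositive)
    (hPint : ∀ t₀ ≥ 0, IntervalIntegrable P volume t₀ (t₀ + δ))
    (hlower : ∀ t₀ ≥ 0, ∀ v, c * ‖v‖ ^ 2 ≤ ∫ t in t₀..(t₀ + δ), ⟪P t v, v⟫_ℝ)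
    (hupper : ∀ t₀ ≥ 0, ∀ v, ∫ t in t₀..(t₀ + δ), ⟪P t v, v⟫_ℝ ≤ C * ‖v‖ ^ 2) :
    UniformlyExciting P δ c (Fintype.card ι * C) := by
  refine ⟨hP, hPint, fun t₀ ht₀ => ?_, hlower⟩
  have hinner (i : ι) := intervalIntegrable_inner_apply (hPint t₀ ht₀) (b i)
  calc ∫ t in t₀..(t₀ + δ), ‖P t‖
      ≤ ∫ t in t₀..(t₀ + δ), ∑ i, ⟪P t (b i), b i⟫_ℝ :=
        intervalIntegral.integral_mono_on (by linarith) (hPint t₀ ht₀).norm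
          (by simpa only [Finset.sum_fn] using
            IntervalIntegrable.sum Finset.univ fun i _ => hinner i)
          fun t _ => opNorm_le_sum_inner_of_isPositive (hP t) b
    _ = ∑ i, ∫ t in t₀..(t₀ + δ), ⟪P t (b i), b i⟫_ℝ :=
        intervalIntegral.integral_finsetSum fun i _ => hinner i
    _ ≤ ∑ _i : ι, C := Finset.sum_le_sum fun i _ => by simpa using hupper t₀ ht₀ (b i)
    _ = Fintype.card ι * C := by rw [Finset.sum_const, nsmul_eq_mul, Finset.card_univ]

theorem UniformlyExciting.integral_const_mul_one_add_norm_le {P : ℝ → E →L[ℝ] E} {δ c C k t₀ : ℝ}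
    (hP : UniformlyExciting P δ c C) (hk : 0 ≤ k) (ht₀ : 0 ≤ t₀) :
    ∫ t in t₀..(t₀ + δ), k * (1 + ‖P t‖) ≤ k * (δ + C) := by
  rw [intervalIntegral.integral_const_mul, intervalIntegral.integral_add
    intervalIntegrable_const (hP.intervalIntegrable t₀ ht₀).norm, intervalIntegral.integral_const,
    add_sub_cancel_left, smul_eq_mul, mul_one]
  gcongr
  exact hP.integral_norm_le t₀ ht₀

end FiniteDimensional

section EuclideanSum

variable {m n : Type*} [Fintype m] [Fintype n]

theorem norm_sq_eq_sumEquivProd (x : EuclideanSpace ℝ (m ⊕ n)) :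
    ‖x‖ ^ 2 =
      ‖(EuclideanSpace.sumEquivProd x).1‖ ^ 2 + ‖(EuclideanSpace.sumEquivProd x).2‖ ^ 2 := by
  rw [← (PiLp.sumPiLpEquivProdLpPiLp (𝕜 := ℝ) 2 _).norm_map x, WithLp.prod_norm_sq_eq_of_L2]
  rfl

theorem norm_le_norm_fst_add_norm_snd (x : EuclideanSpace ℝ (m ⊕ n)) :
    ‖x‖ ≤ ‖(EuclideanSpace.sumEquivProd x).1‖ + ‖(EuclideanSpace.sumEquivProd x).2‖ := by
  refine le_of_sq_le_sq ?_ (by positivity)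
  rw [norm_sq_eq_sumEquivProd, add_sq]
  linarith [mul_nonneg (norm_nonneg (EuclideanSpace.sumEquivProd x).1)
    (norm_nonneg (EuclideanSpace.sumEquivProd x).2)]

theorem norm_fst_add_norm_snd_le (x : EuclideanSpace ℝ (m ⊕ n)) :
    ‖(EuclideanSpace.sumEquivProd x).1‖ + ‖(EuclideanSpace.sumEquivProd x).2‖ ≤ 2 * ‖x‖ := by
  have := norm_sq_eq_sumEquivProd x
  rw [two_mul]
  refine add_le_add (le_of_sq_le_sq ?_ (norm_nonneg x)) (le_of_sq_le_sq ?_ (norm_nonneg x))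
  · exact this ▸ le_add_of_nonneg_right (sq_nonneg _)
  · exact this ▸ le_add_of_nonneg_left (sq_nonneg _)

end EuclideanSum

section EuclideanMatrix

open Matrix (toEuclideanCLM toEuclideanLin)

variable {m n : Type*} [Fintype m] [Fintype n] [DecidableEq m] [DecidableEq n]

theorem exp_toEuclideanCLM (M : Matrix n n ℝ) :
    NormedSpace.exp (toEuclideanCLM (𝕜 := ℝ) M) = toEuclideanCLM (𝕜 := ℝ) (NormedSpace.exp M) := by
  have hcont : Continuous (toEuclideanCLM (n := n) (𝕜 := ℝ)) :=
    (AddMonoidHomClass.isometry_of_norm _ fun _ => rfl).continuous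
  let := NormedAlgebra.restrictScalars ℚ ℝ (Matrix n n ℝ)
  let := NormedAlgebra.restrictScalars ℚ ℝ (EuclideanSpace ℝ n →L[ℝ] EuclideanSpace ℝ n)
  exact (NormedSpace.map_exp (toEuclideanCLM (𝕜 := ℝ)) hcont M).symm

theorem IsHurwitz.exists_norm_exp_smul_toEuclideanCLM_le {M : Matrix n n ℝ} (hM : IsHurwitz M) :
    ∃ C > 0, ∃ α > 0, ∀ t ≥ (0 : ℝ),
      ‖NormedSpace.exp (t • toEuclideanCLM (𝕜 := ℝ) M)‖ ≤ C * Real.exp (-(α * t)) := by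
  simpa only [← map_smul, exp_toEuclideanCLM, Matrix.l2_opNorm_toEuclideanCLM] using
    hM.exists_norm_exp_smul_le

theorem norm_toContinuousLinearMap_mul_le {l : Type*} [Fintype l]
    (B : Matrix l m ℝ) (W : Matrix m n ℝ) :
    ‖(toEuclideanLin (B * W)).toContinuousLinearMap‖ ≤
      ‖B‖ * (1 + ‖toEuclideanCLM (𝕜 := ℝ) (Wᵀ * W)‖) := by
  have hW : ‖Wᵀ * W‖ = ‖W‖ * ‖W‖ := Matrix.l2_opNorm_conjTranspose_mul_self W
  refine (Matrix.l2_opNorm_mul B W).trans ?_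
  rw [Matrix.l2_opNorm_toEuclideanCLM, hW]
  gcongr
  nlinarith [sq_nonneg (‖W‖ - 1)]

theorem isPositive_toEuclideanCLM {M : Matrix n n ℝ} (hM : M.PosSemidef) :
    (toEuclideanCLM (𝕜 := ℝ) M).IsPositive :=
  (LinearMap.isPositive_toContinuousLinearMap_iff _).2 (Matrix.isPositive_toEuclideanLin_iff.2 hM)

theorem inner_toEuclideanCLM_le_of_posSemidef_sub {M N : Matrix n n ℝ} (h : (M - N).PosSemidef)
    (v : EuclideanSpace ℝ n) :
    ⟪toEuclideanCLM (𝕜 := ℝ) N v, v⟫_ℝ ≤ ⟪toEuclideanCLM (𝕜 := ℝ) M v, v⟫_ℝ := by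
  have := (isPositive_toEuclideanCLM h).inner_nonneg_left v
  rw [map_sub, sub_apply, inner_sub_left] at this
  linarith

theorem inner_toEuclideanCLM_smul_one (c : ℝ) (v : EuclideanSpace ℝ n) :
    ⟪toEuclideanCLM (𝕜 := ℝ) (c • (1 : Matrix n n ℝ)) v, v⟫_ℝ = c * ‖v‖ ^ 2 := by
  rw [map_smul, map_one, smul_apply, one_apply_eq_self, real_inner_smul_left,
    real_inner_self_eq_norm_sq]

theorem inner_toEuclideanCLM_integral {M : ℝ → Matrix n n ℝ} {a b : ℝ}
    (hM : IntervalIntegrable M volume a b) (v : EuclideanSpace ℝ n) :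
    ⟪toEuclideanCLM (𝕜 := ℝ) (∫ t in a..b, M t) v, v⟫_ℝ =
      ∫ t in a..b, ⟪toEuclideanCLM (𝕜 := ℝ) (M t) v, v⟫_ℝ := by
  let L : Matrix n n ℝ →ₗ[ℝ] ℝ := (innerSLFlip ℝ v).toLinearMap ∘ₗ
    (ContinuousLinearMap.apply ℝ _ v).toLinearMap ∘ₗ
      (toEuclideanCLM (n := n) (𝕜 := ℝ)).toAlgEquiv.toLinearMap
  exact (L.toContinuousLinearMap.intervalIntegral_comp_comm hM).symm

theorem intervalIntegrable_toEuclideanCLM {M : ℝ → Matrix n n ℝ} {a b : ℝ}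
    (hM : IntervalIntegrable M volume a b) :
    IntervalIntegrable (fun t => toEuclideanCLM (𝕜 := ℝ) (M t)) volume a b := by
  let L := (toEuclideanCLM (n := n) (𝕜 := ℝ)).toAlgEquiv.toLinearMap.toContinuousLinearMap
  exact ⟨L.integrable_comp hM.1, L.integrable_comp hM.2⟩

-- The integral of a non-integrable function is `0`, which is not positive definite.
theorem intervalIntegrable_of_posDef_integral_sub {M : ℝ → Matrix n n ℝ} {a b c : ℝ} (hc : 0 ≤ c)
    (h : ((∫ t in a..b, M t) - c • (1 : Matrix n n ℝ)).PosDef) :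
    IntervalIntegrable M volume a b := by
  cases isEmpty_or_nonempty n
  · rw [Subsingleton.elim M 0]
    exact intervalIntegrable_const (c := 0)
  · by_contra hM
    rw [intervalIntegral.integral_undef hM] at h
    have := h.diag_pos (i := Classical.arbitrary n)
    simp only [zero_sub, Matrix.neg_apply, Matrix.smul_apply, Matrix.one_apply_eq, smul_eq_mul,
      mul_one] at this
    linarith

theorem PersistentlyExciting.exists_uniformlyExciting {q p : ℕ}
    {W : ℝ → Matrix (Fin q) (Fin p) ℝ} (hW : PersistentlyExciting W) :
    ∃ δ > (0 : ℝ), ∃ c > (0 : ℝ), ∃ C,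
      UniformlyExciting (fun t => toEuclideanCLM (𝕜 := ℝ) ((W t)ᵀ * W t)) δ c C := by
  obtain ⟨δ, hδ, c₁, -, c₂, hc₂, hexc⟩ := hW
  have hint (t₀ : ℝ) (ht₀ : 0 ≤ t₀) :=
    intervalIntegrable_of_posDef_integral_sub hc₂.le (hexc t₀ ht₀).2
  refine ⟨δ, hδ, c₂, hc₂, _, .of_integral_inner_le (C := c₁) (EuclideanSpace.basisFun (Fin p) ℝ)
    hδ.le (fun t => isPositive_toEuclideanCLM (Matrix.posSemidef_conjTranspose_mul_self (W t)))
    (fun t₀ ht₀ => intervalIntegrable_toEuclideanCLM (hint t₀ ht₀)) (fun t₀ ht₀ v => ?_)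
    fun t₀ ht₀ v => ?_⟩
  · rw [← inner_toEuclideanCLM_integral (hint t₀ ht₀), ← inner_toEuclideanCLM_smul_one]
    exact inner_toEuclideanCLM_le_of_posSemidef_sub (hexc t₀ ht₀).2.posSemidef v
  · rw [← inner_toEuclideanCLM_integral (hint t₀ ht₀), ← inner_toEuclideanCLM_smul_one]
    exact inner_toEuclideanCLM_le_of_posSemidef_sub (hexc t₀ ht₀).1.posSemidef v

theorem sumEquivProd_toEuclideanCLM_fromBlocks (A : Matrix m m ℝ) (B : Matrix m n ℝ)
    (C : Matrix n m ℝ) (D : Matrix n n ℝ) (x : EuclideanSpace ℝ (m ⊕ n)) :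
    EuclideanSpace.sumEquivProd (toEuclideanCLM (𝕜 := ℝ) (Matrix.fromBlocks A B C D) x) =
      (toEuclideanLin A (EuclideanSpace.sumEquivProd x).1 +
        toEuclideanLin B (EuclideanSpace.sumEquivProd x).2,
       toEuclideanLin C (EuclideanSpace.sumEquivProd x).1 +
        toEuclideanLin D (EuclideanSpace.sumEquivProd x).2) := by
  ext i
  · exact congrFun (Matrix.fromBlocks_mulVec A B C D x.ofLp) (.inl i)
  · exact congrFun (Matrix.fromBlocks_mulVec A B C D x.ofLp) (.inr i)

theorem IsStateTransitionMatrix.hasACDerivOn_apply {F : ℝ → Matrix n n ℝ}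
    {Φ : ℝ → ℝ → Matrix n n ℝ} (hΦ : IsStateTransitionMatrix F Φ) (v : EuclideanSpace ℝ n)
    (s a b : ℝ) :
    HasACDerivOn (fun t => toEuclideanCLM (𝕜 := ℝ) (Φ t s) v)
      (fun t => toEuclideanCLM (𝕜 := ℝ) (F t) (toEuclideanCLM (𝕜 := ℝ) (Φ t s) v)) a b := by
  let L := (ContinuousLinearMap.apply ℝ (EuclideanSpace ℝ n) v).toLinearMap ∘ₗ
      (toEuclideanCLM (n := n) (𝕜 := ℝ)).toAlgEquiv.toLinearMap
  have hΦs : HasACDerivOn (fun t => Φ t s) (fun t => F t * Φ t s) a b :=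
    ⟨hΦ.absolutelyContinuous s a b, (hΦ.hasDerivAt s).mono fun _ ht _ => ht⟩
  simpa [L] using hΦs.clm_comp L.toContinuousLinearMap

end EuclideanMatrix

section ErrorDynamics

open Matrix (toEuclideanCLM toEuclideanLin)

variable {d q p : ℕ} {A : Matrix (Fin d) (Fin d) ℝ} {B : Matrix (Fin d) (Fin q) ℝ}
  {K : Matrix (Fin q) (Fin d) ℝ} {W : ℝ → Matrix (Fin q) (Fin p) ℝ}
  {x : ℝ → EuclideanSpace ℝ (Fin d ⊕ Fin p)} {a b : ℝ}

theorem hasACDerivOn_trackingError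
    (hx : HasACDerivOn x (fun t => toEuclideanCLM (𝕜 := ℝ) (errorDynamics A B K W t) (x t)) a b) :
    HasACDerivOn (fun t => (EuclideanSpace.sumEquivProd (x t)).1)
      (fun t => toEuclideanCLM (𝕜 := ℝ) (A + B * K) (EuclideanSpace.sumEquivProd (x t)).1 +
        (toEuclideanLin (B * W t)).toContinuousLinearMap
          (EuclideanSpace.sumEquivProd (x t)).2) a b := by
  have hfst : HasACDerivOn (fun t => (EuclideanSpace.sumEquivProd (x t)).1) (fun t =>
      (EuclideanSpace.sumEquivProd
        (toEuclideanCLM (𝕜 := ℝ) (errorDynamics A B K W t) (x t))).1) a b :=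
    hx.clm_comp (ContinuousLinearMap.fst ℝ (EuclideanSpace ℝ (Fin d)) (EuclideanSpace ℝ (Fin p)) ∘L
      (EuclideanSpace.sumEquivProd (𝕜 := ℝ)).toContinuousLinearMap)
  simp only [errorDynamics, sumEquivProd_toEuclideanCLM_fromBlocks] at hfst
  exact hfst

theorem hasACDerivOn_parameterError
    (hx : HasACDerivOn x (fun t => toEuclideanCLM (𝕜 := ℝ) (errorDynamics A B K W t) (x t)) a b) :
    HasACDerivOn (fun t => (EuclideanSpace.sumEquivProd (x t)).2)
      (fun t => -(toEuclideanCLM (𝕜 := ℝ) ((W t)ᵀ * W t) (EuclideanSpace.sumEquivProd (x t)).2))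
      a b := by
  have hsnd : HasACDerivOn (fun t => (EuclideanSpace.sumEquivProd (x t)).2) (fun t =>
      (EuclideanSpace.sumEquivProd
        (toEuclideanCLM (𝕜 := ℝ) (errorDynamics A B K W t) (x t))).2) a b :=
    hx.clm_comp (ContinuousLinearMap.snd ℝ (EuclideanSpace ℝ (Fin d)) (EuclideanSpace ℝ (Fin p)) ∘L
      (EuclideanSpace.sumEquivProd (𝕜 := ℝ)).toContinuousLinearMap)
  simp only [errorDynamics, sumEquivProd_toEuclideanCLM_fromBlocks, map_zero, map_neg,
    LinearMap.zero_apply, LinearMap.neg_apply, zero_add] at hsnd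
  exact hsnd

theorem exists_norm_le_of_errorDynamics (hAK : IsHurwitz (A + B * K))
    (hW : PersistentlyExciting W) :
    ∃ M > (0 : ℝ), ∃ ζ > (0 : ℝ), ∀ (x : ℝ → EuclideanSpace ℝ (Fin d ⊕ Fin p)) (s t : ℝ),
      0 ≤ s → s ≤ t →
      (∀ a b, HasACDerivOn x
        (fun t => toEuclideanCLM (𝕜 := ℝ) (errorDynamics A B K W t) (x t)) a b) →
      ‖x t‖ ≤ M * Real.exp (-(ζ * (t - s))) * ‖x s‖ := by
  obtain ⟨δ, hδ, c, hc, C, hP⟩ := hW.exists_uniformlyExciting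
  obtain ⟨M, hM, ζ, hζ, hdecay⟩ := exists_norm_le_of_cascade hδ hc hP
    hAK.exists_norm_exp_smul_toEuclideanCLM_le
    (fun t => norm_toContinuousLinearMap_mul_le B (W t))
    (fun t₀ ht₀ => (intervalIntegrable_const.add (hP.intervalIntegrable t₀ ht₀).norm).const_mul _)
    (fun t₀ ht₀ => hP.integral_const_mul_one_add_norm_le (norm_nonneg B) ht₀)
  refine ⟨M * 2, by positivity, ζ, hζ, fun x s t hs hst hx => ?_⟩
  have hsum := hdecay (fun τ => (EuclideanSpace.sumEquivProd (x τ)).1)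
    (fun τ => (EuclideanSpace.sumEquivProd (x τ)).2) s t hs hst
    (fun a b => hasACDerivOn_trackingError (hx a b))
    (fun a b => hasACDerivOn_parameterError (hx a b))
  calc ‖x t‖
      ≤ ‖(EuclideanSpace.sumEquivProd (x t)).1‖ + ‖(EuclideanSpace.sumEquivProd (x t)).2‖ :=
        norm_le_norm_fst_add_norm_snd (x t)
    _ ≤ M * Real.exp (-(ζ * (t - s))) *
        (‖(EuclideanSpace.sumEquivProd (x s)).1‖ + ‖(EuclideanSpace.sumEquivProd (x s)).2‖) := hsum
    _ ≤ M * Real.exp (-(ζ * (t - s))) * (2 * ‖x s‖) := by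
        gcongr
        exact norm_fst_add_norm_snd_le (x s)
    _ = M * 2 * Real.exp (-(ζ * (t - s))) * ‖x s‖ := by ring

end ErrorDynamics

theorem lemma1_general {d q p : ℕ}
    (A : Matrix (Fin d) (Fin d) ℝ) (B : Matrix (Fin d) (Fin q) ℝ) (K : Matrix (Fin q) (Fin d) ℝ)
    (hAK : IsHurwitz (A + B * K))
    (W : ℝ → Matrix (Fin q) (Fin p) ℝ)
    (hpe : PersistentlyExciting W)
    (Φ : ℝ → ℝ → Matrix (Fin d ⊕ Fin p) (Fin d ⊕ Fin p) ℝ)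
    (hΦ : IsStateTransitionMatrix (errorDynamics A B K W) Φ) :
    ∃ M > (0 : ℝ), ∃ ζ > (0 : ℝ), ∀ t₁ t₂ : ℝ, 0 ≤ t₂ → t₂ ≤ t₁ →
      ‖Φ t₁ t₂‖ ≤ M * Real.exp (-ζ * (t₁ - t₂)) := by
  obtain ⟨M, hM, ζ, hζ, hdecay⟩ := exists_norm_le_of_errorDynamics hAK hpe
  refine ⟨M, hM, ζ, hζ, fun t₁ t₂ ht₂ ht => ?_⟩
  rw [← Matrix.l2_opNorm_toEuclideanCLM]
  refine ContinuousLinearMap.opNorm_le_bound _ (by positivity) fun v => ?_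
  have hv := hdecay _ t₂ t₁ ht₂ ht (hΦ.hasACDerivOn_apply v t₂)
  rwa [hΦ.self, map_one, one_apply_eq_self, ← neg_mul] at hv

theorem lemma1 {d q p : ℕ}
    (A : Matrix (Fin d) (Fin d) ℝ) (B : Matrix (Fin d) (Fin q) ℝ) (K : Matrix (Fin q) (Fin d) ℝ)
    (hAK : IsHurwitz (A + B * K))
    (W : ℝ → Matrix (Fin q) (Fin p) ℝ) (hW : AEStronglyMeasurable W volume)
    (hbdd : ∃ C > (0 : ℝ), ∀ t : ℝ, ‖W t‖ < C)
    (hpe : PersistentlyExciting W)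
    (Φ : ℝ → ℝ → Matrix (Fin d ⊕ Fin p) (Fin d ⊕ Fin p) ℝ)
    (hΦ : IsStateTransitionMatrix (errorDynamics A B K W) Φ) :
    ∃ M > (0 : ℝ), ∃ ζ > (0 : ℝ), ∀ t₁ t₂ : ℝ, 0 ≤ t₂ → t₂ ≤ t₁ →
      ‖Φ t₁ t₂‖ ≤ M * Real.exp (-ζ * (t₁ - t₂)) :=
  lemma1_general A B K hAK W hpe Φ hΦ
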